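/- Let $G$ be a group that is a central product of two normal subgroups $H$ and $K$, that is, $G=HK$ and $[H,K]=1$. Put $A=H\cap K$ and $Z=H'\cap K'$, where $X'$ denotes the commutator subgroup of $X$; then $Z\le A$. Let $D$ be a divisible abelian group, regarded as a trivial module for every group below. For groups $X,Y$ let $X\otimes Y$ be the abelian tensor product $X/X'\otimes_{\mathbb Z} Y/Y'$. For a group $X$ with a central subgroup $B$, let $\operatorname{tra}\colon \operatorname{Hom}(B,D)\to H^2(X/B,D)$ be the transgression: $\operatorname{tra}(\beta)$ is the class of the 2-cocycle $(x,y)\mapsto \beta(\mu(x)\mu(y)\mu(xy)^{-1})$, where $\mu\colon X/B\to X$ is a section. Let $L\le H^2(H/A,D)$ and $M\le H^2(K/A,D)$ be the images of $\operatorname{Hom}(A/Z,D)=\{\beta\in\operatorname{Hom}(A,D):\beta|_Z=0\}$ under $\operatorname{tra}_{H/A}\colon\operatorname{Hom}(A,D)\to H^2(H/A,D)$ and $\operatorname{tra}_{K/A}\colon\operatorname{Hom}(A,D)\to H^2(K/A,D)$. Let $$N_1=\{(\operatorname{tra}_{H/A}(\beta)+L,\ \operatorname{tra}_{K/A}(\beta)+M):\beta\in\operatorname{Hom}(A,D)\}\le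 H^2(H/A,D)/L\oplus H^2(K/A,D)/M,$$ $$N_2=\{(\operatorname{tra}_{H/Z}(\beta),\ \operatorname{tra}_{K/Z}(\beta)):\beta\in\operatorname{Hom}(Z,D)\}\le H^2(H/Z,D)\oplus H^2(K/Z,D).$$ Then $$L\cong\operatorname{Hom}\big((A\cap H')/Z,D\big),\qquad M\cong\operatorname{Hom}\big((A\cap K')/Z,D\big),\qquad N_1\cong N_2\cong\operatorname{Hom}(Z,D),$$ and the following hold. (i) The group $\big(H^2(H/A,D)/L\oplus H^2(K/A,D)/M\big)/N_1\ \oplus\ \operatorname{Hom}(H/A\otimes K/A,\,D)$ embeds in $H^2(G,D)$. (ii) The group $H^2(G,D)$ embeds in $\big(H^2(H/Z,D)\oplus H^2(K/Z,D)\big)/N_2\ \oplus\ \operatorname{Hom}(H\otimes K,\,D)$. -/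

import Mathlib

open scoped TensorProduct

universe u

namespace CentralProduct

/-- `G` is the (internal) central product of its subgroups `H` and `K`: `G = HK` and `[H, K] = 1`.
The amalgamated subgroup is `A = H ⊓ K`. -/
structure IsCentralProduct {G : Type u} [Group G] (H K : Subgroup G) : Prop where
  exists_mul_eq : ∀ g : G, ∃ h ∈ H, ∃ k ∈ K, h * k = g
  commutator_eq_bot : ⁅H, K⁆ = ⊥

/-- The second cohomology group `H²(X, D)` of `X` with coefficients in the abelian group `D`, on
which `X` acts trivially. (`ULift ℤ` is the ring of integers in the universe of `X` and `D`.) -/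
abbrev H2 (X D : Type u) [Group X] [AddCommGroup D] : Type u :=
  groupCohomology.H2 (Rep.trivial (ULift.{u} ℤ) X D)

/-- `Hom(X, D)` for a group `X` and an (additively written) abelian group `D`. -/
abbrev HomTo (X D : Type u) [Group X] [AddCommGroup D] : Type u := Additive X →+ D

/-- The abelian tensor product of two groups, `X ⊗ Y = X/X' ⊗ Y/Y'`. -/
abbrev AbTensor (X Y : Type u) [Group X] [Group Y] : Type u :=
  Additive (Abelianization X) ⊗[ℤ] Additive (Abelianization Y)

section Transgression

variable {X : Type u} [Group X] (N : Subgroup X) [N.Normal]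

/-- The factor set `μ(x) μ(y) μ(xy)⁻¹ ∈ N` of the extension `1 → N → X → X/N → 1`, for the section
`μ : X/N → X` that picks a representative of each coset. -/
noncomputable def factorSet (x y : X ⧸ N) : N :=
  ⟨x.out * y.out * (x * y).out⁻¹, by
    rw [← QuotientGroup.eq_one_iff]
    simp⟩

variable {N}

theorem factorSet_cocycle (hN : N ≤ Subgroup.center X) (x y z : X ⧸ N) :
    factorSet N (x * y) z * factorSet N x y = factorSet N y z * factorSet N x (y * z) := by
  have hc : ∀ (n : N) (g : X), (n : X) * g = g * n := fun n g =>
    ((Subgroup.mem_center_iff.mp (hN n.2)) g).symm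
  have e : ∀ a b : X ⧸ N, (factorSet N a b : X) * (a * b).out = a.out * b.out := fun a b => by
    simp [factorSet]
  apply Subtype.ext
  have h1 : ((factorSet N (x * y) z * factorSet N x y : N) : X) * (x * y * z).out
      = x.out * y.out * z.out := by
    rw [Subgroup.coe_mul, hc, mul_assoc, e, ← mul_assoc, e]
  have h2 : ((factorSet N y z * factorSet N x (y * z) : N) : X) * (x * y * z).out
      = x.out * y.out * z.out := by
    rw [Subgroup.coe_mul, mul_assoc x y z, mul_assoc, e, ← mul_assoc, hc, mul_assoc, e, mul_assoc]
  exact mul_right_cancel (h1.trans h2.symm)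

/-- The 2-cocycle `(x, y) ↦ β (μ(x) μ(y) μ(xy)⁻¹)` of `X/N` attached to `β ∈ Hom(N, D)`, for `N`
central in `X`. It is additive in `β`. -/
noncomputable def traCocycle (D : Type u) [AddCommGroup D] (hN : N ≤ Subgroup.center X) :
    HomTo N D →+ groupCohomology.cocycles₂ (Rep.trivial (ULift.{u} ℤ) (X ⧸ N) D) where
  toFun β := ⟨fun p => β (Additive.ofMul (factorSet N p.1 p.2)), by
    rw [groupCohomology.mem_cocycles₂_iff]
    intro x y z
    rw [Rep.trivial_ρ_apply]
    have e := congrArg (fun n => β (Additive.ofMul n)) (factorSet_cocycle hN x y z)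
    simpa only [ofMul_mul, map_add] using! e⟩
  map_zero' := by ext; rfl
  map_add' β γ := by ext; rfl

/-- The transgression `Hom(N, D) → H²(X/N, D)` of the central extension
`1 → N → X → X/N → 1`. -/
noncomputable def transgression (D : Type u) [AddCommGroup D] (hN : N ≤ Subgroup.center X) :
    HomTo N D →+ H2 (X ⧸ N) D :=
  (groupCohomology.H2π (Rep.trivial (ULift.{u} ℤ) (X ⧸ N) D)).hom.toAddMonoidHom.comp
    (traCocycle D hN)

end Transgression

section Subgroups

variable {G : Type u} [Group G]

/-- For subgroups `B ≤ H` of `G`, with `B` normal in `G` and centralized by `H`: the transgression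
`Hom(B, D) → H²(H/B, D)` of the central extension `1 → B → H → H/B → 1`. -/
noncomputable def tra (D : Type u) [AddCommGroup D] (H B : Subgroup G) [B.Normal] (hBH : B ≤ H)
    (hc : B.subgroupOf H ≤ Subgroup.center H) :
    HomTo B D →+ H2 (H ⧸ B.subgroupOf H) D :=
  (transgression D hc).comp
    (AddMonoidHom.compHom'
      (MonoidHom.toAdditive (Subgroup.subgroupOfEquivOfLe hBH).toMonoidHom))

/-- The subgroup of `Hom(A, D)` formed by the homomorphisms that vanish on `Z`,
i.e. `Hom(A/Z, D)`. -/
def vanishingOn (D : Type u) [AddCommGroup D] (A Z : Subgroup G) : AddSubgroup (HomTo A D) where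
  carrier := {β | ∀ a : A, (a : G) ∈ Z → β (Additive.ofMul a) = 0}
  zero_mem' _ _ := rfl
  add_mem' hβ hγ a ha := by rw [AddMonoidHom.add_apply, hβ a ha, hγ a ha, add_zero]
  neg_mem' hβ a ha := by rw [AddMonoidHom.neg_apply, hβ a ha, neg_zero]

variable (H K : Subgroup G)

/-- `Z = H' ∩ K'`, a subgroup of `A = H ∩ K`. -/
abbrev Z : Subgroup G := ⁅H, H⁆ ⊓ ⁅K, K⁆

variable {H K}

theorem Z_le_left : Z H K ≤ H := inf_le_left.trans (Subgroup.commutator_le_self H)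

theorem Z_le_right : Z H K ≤ K := inf_le_right.trans (Subgroup.commutator_le_self K)

theorem commute_of_mem (h : IsCentralProduct H K) {x y : G} (hx : x ∈ H) (hy : y ∈ K) :
    x * y = y * x :=
  (Subgroup.mem_centralizer_iff.mp
    (Subgroup.commutator_eq_bot_iff_le_centralizer.mp h.commutator_eq_bot hx) y hy).symm

theorem subgroupOf_le_center_left (h : IsCentralProduct H K) {B : Subgroup G} (hB : B ≤ K) :
    B.subgroupOf H ≤ Subgroup.center H := fun _ hb =>
  Subgroup.mem_center_iff.mpr fun g => Subtype.ext
    (commute_of_mem h g.2 (hB (Subgroup.mem_subgroupOf.mp hb)))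

theorem subgroupOf_le_center_right (h : IsCentralProduct H K) {B : Subgroup G} (hB : B ≤ H) :
    B.subgroupOf K ≤ Subgroup.center K := fun _ hb =>
  Subgroup.mem_center_iff.mpr fun g => Subtype.ext
    (commute_of_mem h (hB (Subgroup.mem_subgroupOf.mp hb)) g.2).symm

variable [H.Normal] [K.Normal]

/-- The transgression `Hom(A, D) → H²(H/A, D)`. -/
noncomputable def traHA (D : Type u) [AddCommGroup D] (h : IsCentralProduct H K) :
    HomTo ↥(H ⊓ K) D →+ H2 (H ⧸ (H ⊓ K).subgroupOf H) D :=
  tra D H (H ⊓ K) inf_le_left (subgroupOf_le_center_left h inf_le_right)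

/-- The transgression `Hom(A, D) → H²(K/A, D)`. -/
noncomputable def traKA (D : Type u) [AddCommGroup D] (h : IsCentralProduct H K) :
    HomTo ↥(H ⊓ K) D →+ H2 (K ⧸ (H ⊓ K).subgroupOf K) D :=
  tra D K (H ⊓ K) inf_le_right (subgroupOf_le_center_right h inf_le_left)

/-- The transgression `Hom(Z, D) → H²(H/Z, D)`. -/
noncomputable def traHZ (D : Type u) [AddCommGroup D] (h : IsCentralProduct H K) :
    HomTo ↥(Z H K) D →+ H2 (H ⧸ (Z H K).subgroupOf H) D :=
  tra D H (Z H K) Z_le_left (subgroupOf_le_center_left h Z_le_right)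

/-- The transgression `Hom(Z, D) → H²(K/Z, D)`. -/
noncomputable def traKZ (D : Type u) [AddCommGroup D] (h : IsCentralProduct H K) :
    HomTo ↥(Z H K) D →+ H2 (K ⧸ (Z H K).subgroupOf K) D :=
  tra D K (Z H K) Z_le_right (subgroupOf_le_center_right h Z_le_left)

/-- The subgroup `L` of `H²(H/A, D)`: the image of `Hom(A/Z, D)` under the transgression of
`1 → A/Z → H/Z → H/A → 1`. A section `H/A → H` also gives a section `H/A → H/Z`, so
this is the set of the transgressions of those `β : A → D` that vanish on `Z`. -/
noncomputable def L (D : Type u) [AddCommGroup D] (h : IsCentralProduct H K) :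
    AddSubgroup (H2 (H ⧸ (H ⊓ K).subgroupOf H) D) :=
  (vanishingOn D (H ⊓ K) (Z H K)).map (traHA D h)

/-- The subgroup `M` of `H²(K/A, D)`: the image of `Hom(A/Z, D)` under the transgression of
`1 → A/Z → K/Z → K/A → 1`. -/
noncomputable def M (D : Type u) [AddCommGroup D] (h : IsCentralProduct H K) :
    AddSubgroup (H2 (K ⧸ (H ⊓ K).subgroupOf K) D) :=
  (vanishingOn D (H ⊓ K) (Z H K)).map (traKA D h)

/-- The copy of `Hom(Z, D)` in `H²(H/A, D)/L ⊕ H²(K/A, D)/M`: it consists of the pairs of classes of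
the transgressions of `β`, where `β` runs over `Hom(A, D)`. The pair depends on `β|_Z` only. -/
noncomputable def N₁ (D : Type u) [AddCommGroup D] (h : IsCentralProduct H K) :
    AddSubgroup ((H2 (H ⧸ (H ⊓ K).subgroupOf H) D ⧸ L D h) ×
      (H2 (K ⧸ (H ⊓ K).subgroupOf K) D ⧸ M D h)) :=
  (((QuotientAddGroup.mk' (L D h)).comp (traHA D h)).prod
    ((QuotientAddGroup.mk' (M D h)).comp (traKA D h))).range

/-- The copy of `Hom(Z, D)` in `H²(H/Z, D) ⊕ H²(K/Z, D)`: it consists of the pairs of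
transgressions of `β`, where `β` runs over `Hom(Z, D)`. -/
noncomputable def N₂ (D : Type u) [AddCommGroup D] (h : IsCentralProduct H K) :
    AddSubgroup (H2 (H ⧸ (Z H K).subgroupOf H) D × H2 (K ⧸ (Z H K).subgroupOf K) D) :=
  ((traHZ D h).prod (traKZ D h)).range

end Subgroups

end CentralProduct

/-! All isomorphisms and embeddings come from one device: two homomorphisms out of a common group,
the first surjective, with equal kernels, give an injection between their targets
(`exists_injective_of_ker_eq`). The common group consists of explicit cocycles, so the work lies in
deciding which cocycles are coboundaries.

Divisibility of D enters through `exists_hom_extension`. It shows that the kernel of a transgression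
consists of the homomorphisms vanishing on the intersection with the commutator subgroup
(`tra_eq_zero_iff`). It also splits a homomorphism on A that vanishes on Z into one vanishing on A ∩
H' plus one vanishing on A ∩ K' (`exists_hom_eq_of_vanishingOn`).

For (i), cocycles of H/A and K/A are inflated along G → H/A and G → K/A, and a cup product is added.
The commutator pairing between H and K recovers the bilinear part. The remaining sum splits exactly
when both cocycles represent the transgressions of one β. By the splitting on A, a pair with this
property modulo L and M already has it (`mk_mem_N₁_iff`).

For (ii), inflation from G/Z to G is surjective on H²: a pairing kills commutators, so every cocycle
is symmetric on Z × G and can be pushed down to G/Z. Its inflation splits when the restrictions to H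
and K split by cochains agreeing on A and the pairing vanishes. A common β only gives agreement on Z
up to constants already matched; the splitting on A corrects the rest. -/

namespace CentralProduct

/-! ### Comparing homomorphisms by their kernels. -/

section Abstract

/-- A homomorphism factors through a surjection whose kernel it kills; the factor is injective if
the kernels agree. -/
theorem exists_injective_of_ker_eq {T P Q : Type*} [AddGroup T] [AddGroup P] [AddGroup Q]
    (φ : T →+ P) (ψ : T →+ Q) (hφ : Function.Surjective φ) (h : ∀ t, φ t = 0 ↔ ψ t = 0) :
    ∃ f : P →+ Q, Function.Injective f ∧ ∀ t, f (φ t) = ψ t := by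
  have key : ∀ s t, φ s = φ t ↔ ψ s = ψ t := fun s t => by
    rw [← sub_eq_zero, ← map_sub, h, map_sub, sub_eq_zero]
  choose σ hσ using hφ
  have hf : ∀ t, ψ (σ (φ t)) = ψ t := fun t => (key _ _).mp (hσ _)
  refine ⟨AddMonoidHom.mk' (fun p => ψ (σ p)) fun a b => ?_, fun a b hab => ?_, hf⟩
  · rw [← map_add]
    exact (key _ _).mp (by rw [hσ, map_add, hσ, hσ])
  · rw [← hσ a, ← hσ b]
    exact (key _ _).mpr hab

theorem nonempty_addEquiv_of_ker_eq {T P Q : Type*} [AddGroup T] [AddGroup P] [AddGroup Q]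
    (φ : T →+ P) (ψ : T →+ Q) (hφ : Function.Surjective φ) (hψ : Function.Surjective ψ)
    (h : ∀ t, φ t = 0 ↔ ψ t = 0) : Nonempty (P ≃+ Q) := by
  obtain ⟨f, hf, e⟩ := exists_injective_of_ker_eq φ ψ hφ h
  refine ⟨AddEquiv.ofBijective f ⟨hf, fun q => ?_⟩⟩
  obtain ⟨t, rfl⟩ := hψ q
  exact ⟨φ t, e t⟩

end Abstract

/-! ### Extending homomorphisms into a divisible group. -/

section Extension

variable {X Y D : Type*} [Group X] [Group Y] [AddCommGroup D]

theorem hom_eq_zero_of_mem_commutator (β : Additive X →+ D) {x : X} (hx : x ∈ commutator X) :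
    β (Additive.ofMul x) = 0 := by
  have h := Abelianization.commutator_subset_ker (AddMonoidHom.toMultiplicativeRight β) hx
  exact h

/-- A homomorphism to a divisible group `D` extends along `φ : X → Y` as soon as it vanishes on
the preimage of the commutator subgroup of `Y`. -/
theorem exists_hom_extension [DivisibleBy D ℤ] (φ : X →* Y) (β : Additive X →+ D)
    (hβ : ∀ x, φ x ∈ commutator Y → β (Additive.ofMul x) = 0) :
    ∃ χ : Additive Y →+ D, ∀ x, χ (Additive.ofMul (φ x)) = β (Additive.ofMul x) := by
  -- In the abelianization of `Y` the divisible group `D` is injective, so it suffices that `β`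
  -- descends to the image of `X` there.
  let ψ : Additive X →+ Additive (Abelianization Y) :=
    MonoidHom.toAdditive (Abelianization.of.comp φ)
  have hker : ∀ x, ψ.rangeRestrict x = 0 → β x = 0 := fun x hx => by
    refine hβ x.toMul ?_
    rw [← Abelianization.ker_of]
    exact congrArg (fun r : ψ.range => r.1.toMul) hx
  have key : ∀ s t, ψ.rangeRestrict s = ψ.rangeRestrict t → β s = β t := fun s t hst => by
    rw [← sub_eq_zero, ← map_sub]
    exact hker _ (by rw [map_sub, hst, sub_self])
  choose σ hσ using ψ.rangeRestrict_surjective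
  let g : ψ.range →+ D := AddMonoidHom.mk' (fun p => β (σ p)) fun a b => by
    rw [← map_add]
    exact key _ _ (by rw [hσ, map_add, hσ, hσ])
  obtain ⟨χ, hχ⟩ := (Module.Baer.of_divisible D).extension_property_addMonoidHom
    ψ.range.subtype Subtype.val_injective g
  refine ⟨χ.comp (MonoidHom.toAdditive Abelianization.of), fun x => ?_⟩
  have h1 := DFunLike.congr_fun hχ (ψ.rangeRestrict (Additive.ofMul x))
  exact h1.trans (key _ _ (hσ _))

end Extension

/-! ### 2-cocycles with trivial action, not necessarily normalized. -/

section Cocycles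

/-- The group of 2-cocycles of `X` with values in the trivial module `D`. -/
abbrev Cocycles (X D : Type u) [Group X] [AddCommGroup D] : Type u :=
  groupCohomology.cocycles₂ (Rep.trivial (ULift.{u} ℤ) X D)

variable {X Y D : Type u} [Group X] [Group Y] [AddCommGroup D]

/-- The value of a 2-cocycle. -/
def Cocycles.val (f : Cocycles X D) (x y : X) : D := f.1 (x, y)

/-- The cocycle condition for a trivial module. -/
def IsCocycle (F : X → X → D) : Prop :=
  ∀ x y z, F (x * y) z + F x y = F y z + F x (y * z)

theorem Cocycles.isCocycle (f : Cocycles X D) : IsCocycle f.val := fun x y z => by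
  simpa using! (groupCohomology.mem_cocycles₂_iff f.1).mp f.2 x y z

/-- The 2-cocycle with given values. -/
def Cocycles.mk (F : X → X → D) (hF : IsCocycle F) : Cocycles X D :=
  ⟨fun p => F p.1 p.2, by
    rw [groupCohomology.mem_cocycles₂_iff]
    intro x y z
    simpa using! hF x y z⟩

@[simp]
theorem Cocycles.val_sub (f g : Cocycles X D) (x y : X) :
    (f - g).val x y = f.val x y - g.val x y := rfl

theorem Cocycles.val_one_left (f : Cocycles X D) (x : X) : f.val 1 x = f.val 1 1 := by
  have h := f.isCocycle 1 1 x
  simp only [one_mul] at h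
  exact (add_left_cancel h).symm

theorem Cocycles.val_one_right (f : Cocycles X D) (x : X) : f.val x 1 = f.val 1 1 := by
  have h := f.isCocycle x 1 1
  simp only [mul_one] at h
  exact add_right_cancel h

/-- The restriction of 2-cocycles along a homomorphism. -/
def Cocycles.pull (p : X →* Y) : Cocycles Y D →+ Cocycles X D where
  toFun f := Cocycles.mk (fun x y => f.val (p x) (p y)) fun x y z => by
    simpa using f.isCocycle (p x) (p y) (p z)
  map_zero' := rfl
  map_add' _ _ := rfl

@[simp]
theorem Cocycles.val_pull (p : X →* Y) (f : Cocycles Y D) (x y : X) :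
    (Cocycles.pull p f).val x y = f.val (p x) (p y) := rfl

/-- The function `c` is a cochain with coboundary `f`. -/
def Splits (f : Cocycles X D) (c : X → D) : Prop :=
  ∀ x y, f.val x y = c x + c y - c (x * y)

theorem Splits.val_one {f : Cocycles X D} {c : X → D} (h : Splits f c) : c 1 = f.val 1 1 := by
  simpa using (h 1 1).symm

variable (X D) in
/-- The class of a 2-cocycle. -/
noncomputable def classOf : Cocycles X D →+ H2 X D :=
  (groupCohomology.H2π (Rep.trivial (ULift.{u} ℤ) X D)).hom.toAddMonoidHom

theorem classOf_surjective : Function.Surjective (classOf X D) :=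
  (ModuleCat.epi_iff_surjective _).mp inferInstance

theorem classOf_eq_zero_iff (f : Cocycles X D) : classOf X D f = 0 ↔ ∃ c, Splits f c := by
  refine (groupCohomology.H2π_eq_zero_iff f).trans ?_
  constructor
  · rintro ⟨c, hc⟩
    refine ⟨c, fun x y => ?_⟩
    have h : c y - c (x * y) + c x = f.val x y := congrFun hc (x, y)
    exact h.symm.trans (by abel)
  · rintro ⟨c, hc⟩
    refine ⟨c, funext fun p => ?_⟩
    have h : c p.2 - c (p.1 * p.2) + c p.1 = f.val p.1 p.2 := by
      rw [hc]
      abel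
    exact h

end Cocycles

/-! ### Transgression in terms of split inflations. -/

section Transgression

variable {X D : Type u} [Group X] [AddCommGroup D] {N : Subgroup X} [N.Normal]

theorem classOf_traCocycle (hN : N ≤ Subgroup.center X) (β : HomTo N D) :
    transgression D hN β = classOf (X ⧸ N) D (traCocycle D hN β) := rfl

theorem val_traCocycle (hN : N ≤ Subgroup.center X) (β : HomTo N D) (x y : X ⧸ N) :
    (show Cocycles (X ⧸ N) D from traCocycle D hN β).val x y =
      β (Additive.ofMul (factorSet N x y)) := rfl

variable (N) in
/-- The component in `N` of an element of `X`, relative to the transversal `X/N → X`. -/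
noncomputable def normalPart (x : X) : N :=
  ⟨x * (x : X ⧸ N).out⁻¹, by rw [← QuotientGroup.eq_one_iff]; simp⟩

theorem normalPart_mul_out (x : X) : (normalPart N x : X) * (x : X ⧸ N).out = x := by
  simp [normalPart]

theorem factorSet_mul_out (x y : X ⧸ N) :
    (factorSet N x y : X) * (x * y).out = x.out * y.out := by
  simp [factorSet]

theorem normalPart_mul (hN : N ≤ Subgroup.center X) (x y : X) :
    normalPart N (x * y) = normalPart N x * normalPart N y * factorSet N (x : X ⧸ N) y := by
  have hc : ∀ (n : N) (g : X), (n : X) * g = g * n := fun n g =>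
    ((Subgroup.mem_center_iff.mp (hN n.2)) g).symm
  apply Subtype.ext
  refine mul_right_cancel (b := ((x * y : X) : X ⧸ N).out) ?_
  rw [normalPart_mul_out, Subgroup.coe_mul, mul_assoc, QuotientGroup.mk_mul, factorSet_mul_out,
    Subgroup.coe_mul, mul_assoc, ← mul_assoc (normalPart N y : X), hc (normalPart N y), mul_assoc,
    normalPart_mul_out, ← mul_assoc, normalPart_mul_out]

theorem normalPart_coe_mul (n : N) (x : X) :
    normalPart N (n * x) = n * normalPart N x := by
  apply Subtype.ext
  have : ((n * x : X) : X ⧸ N) = x := by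
    rw [QuotientGroup.mk_mul, (QuotientGroup.eq_one_iff _).mpr n.2, one_mul]
  simp [normalPart, this, mul_assoc]

/-- A 2-cocycle of `X/N` represents `tra β` if and only if its inflation to `X` is the coboundary
of a cochain that restricts to `-β` on `N`, up to a constant. -/
theorem classOf_eq_transgression_iff (hN : N ≤ Subgroup.center X) (f : Cocycles (X ⧸ N) D)
    (β : HomTo N D) :
    classOf (X ⧸ N) D f = transgression D hN β ↔
      ∃ c, Splits (Cocycles.pull (QuotientGroup.mk' N) f) c ∧
        ∀ n : N, β (Additive.ofMul n) = f.val 1 1 - c n := by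
  rw [classOf_traCocycle, ← sub_eq_zero, ← map_sub, classOf_eq_zero_iff]
  constructor
  · rintro ⟨b, hb⟩
    -- By `normalPart_mul`, the inflated factor set is the coboundary of `-β ∘ normalPart`.
    have hs : Splits (Cocycles.pull (QuotientGroup.mk' N) f)
        fun x => b x - β (Additive.ofMul (normalPart N x)) := fun x y => by
      have h := hb x y
      rw [Cocycles.val_sub, val_traCocycle] at h
      simp only [Cocycles.val_pull, QuotientGroup.mk'_apply, normalPart_mul hN, ofMul_mul, map_add,
        QuotientGroup.mk_mul]
      rw [sub_eq_iff_eq_add] at h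
      rw [h]
      abel
    refine ⟨_, hs, fun n => ?_⟩
    have h1 := hs.val_one
    -- The representative of the trivial coset need not be 1, so `normalPart N 1` survives; it is
    -- absorbed in the constant `f.val 1 1`.
    have e := normalPart_coe_mul n 1
    have hn : ((n : X) : X ⧸ N) = ((1 : X) : X ⧸ N) := (QuotientGroup.eq_one_iff _).mpr n.2
    rw [mul_one] at e
    simp only [Cocycles.val_pull, map_one] at h1
    simp only [e, hn, ← h1, ofMul_mul, map_add]
    abel
  · rintro ⟨c, hc, hβ⟩
    have hcn : ∀ (n : N) (x : X), c (n * x) = c x - β (Additive.ofMul n) := fun n x => by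
      have h := hc n x
      simp only [Cocycles.val_pull, QuotientGroup.mk'_apply] at h
      rw [(QuotientGroup.eq_one_iff _).mpr n.2, f.val_one_left] at h
      rw [hβ, h]
      abel
    -- On representatives, the equivariance `hcn` turns the factor set into the correction by `β`.
    refine ⟨fun x => c x.out, fun x y => ?_⟩
    have h := hc x.out y.out
    rw [← factorSet_mul_out, hcn] at h
    simp only [Cocycles.val_pull, QuotientGroup.mk'_apply, QuotientGroup.out_eq'] at h
    rw [Cocycles.val_sub, val_traCocycle, h]
    abel

end Transgression

end CentralProduct

namespace CentralProduct

theorem commutator_eq_bot_of_comm {Y : Type*} [Group Y] (h : ∀ x y : Y, x * y = y * x) :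
    commutator Y = ⊥ := by
  rw [commutator_def, Subgroup.commutator_eq_bot_iff_le_centralizer]
  exact fun x _ => Subgroup.mem_centralizer_iff.mpr fun y _ => h y x

theorem mem_commutator_iff {G : Type*} [Group G] {H : Subgroup G} (x : H) :
    x ∈ commutator H ↔ (x : G) ∈ ⁅H, H⁆ := by
  rw [← Subgroup.map_subtype_commutator]
  exact (Subgroup.mem_map_iff_mem Subtype.val_injective).symm

/-! ### The central extension attached to a cocycle, and descent to a quotient. -/

section Extension

variable {X D : Type u} [Group X] [AddCommGroup D]

/-- The central extension of `X` by `D` with factor set `f`. -/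
@[ext]
structure CocycleExt (f : Cocycles X D) : Type u where
  fst : D
  snd : X

namespace CocycleExt

variable {f : Cocycles X D}

instance : Mul (CocycleExt f) := ⟨fun a b => ⟨a.fst + b.fst + f.val a.snd b.snd, a.snd * b.snd⟩⟩
-- The shift by `-f.val 1 1` is needed because `f` is not normalized.
instance : One (CocycleExt f) := ⟨⟨-f.val 1 1, 1⟩⟩
instance : Inv (CocycleExt f) := ⟨fun a => ⟨-a.fst - f.val a.snd⁻¹ a.snd - f.val 1 1, a.snd⁻¹⟩⟩

@[simp] theorem fst_mul (a b : CocycleExt f) :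
    (a * b).fst = a.fst + b.fst + f.val a.snd b.snd := rfl
@[simp] theorem snd_mul (a b : CocycleExt f) : (a * b).snd = a.snd * b.snd := rfl
@[simp] theorem fst_one : (1 : CocycleExt f).fst = -f.val 1 1 := rfl
@[simp] theorem snd_one : (1 : CocycleExt f).snd = 1 := rfl
@[simp] theorem fst_inv (a : CocycleExt f) :
    a⁻¹.fst = -a.fst - f.val a.snd⁻¹ a.snd - f.val 1 1 := rfl
@[simp] theorem snd_inv (a : CocycleExt f) : a⁻¹.snd = a.snd⁻¹ := rfl

instance : Group (CocycleExt f) :=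
  Group.ofLeftAxioms
    (fun a b c => CocycleExt.ext (by
      have h := f.isCocycle a.snd b.snd c.snd
      simp only [fst_mul, snd_mul]
      rw [← sub_eq_zero] at h ⊢
      rw [← h]
      abel) (mul_assoc _ _ _))
    (fun a => CocycleExt.ext (by simp [f.val_one_left]) (one_mul _))
    (fun a => CocycleExt.ext (by
      simp only [fst_mul, fst_inv, snd_inv, fst_one]
      abel) (inv_mul_cancel _))

/-- Translation by an element of the kernel `D`. -/
def shift (d : D) (a : CocycleExt f) : CocycleExt f := ⟨a.fst + d, a.snd⟩

@[simp] theorem fst_shift (d : D) (a : CocycleExt f) : (shift d a).fst = a.fst + d := rfl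
@[simp] theorem snd_shift (d : D) (a : CocycleExt f) : (shift d a).snd = a.snd := rfl

theorem shift_mul (d : D) (a b : CocycleExt f) : shift d a * b = shift d (a * b) :=
  CocycleExt.ext (by simp only [fst_mul, fst_shift, snd_shift]; abel) rfl

theorem mul_shift (d : D) (a b : CocycleExt f) : a * shift d b = shift d (a * b) :=
  CocycleExt.ext (by simp only [fst_mul, fst_shift, snd_shift]; abel) rfl

/-- The embedding of the kernel `D`. -/
def ofKer (f : Cocycles X D) : Multiplicative D →* CocycleExt f where
  toFun d := shift d.toAdd 1
  map_one' := CocycleExt.ext (add_zero _) rfl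
  map_mul' d e := by
    rw [shift_mul, one_mul]
    exact CocycleExt.ext (by simp only [fst_shift, toAdd_mul]; abel) rfl

/-- The section of the extension given by a cochain whose coboundary is `f`. -/
def lift {Y : Type u} [Group Y] (p : Y →* X) (c : Y → D) (hc : Splits (Cocycles.pull p f) c) :
    Y →* CocycleExt f :=
  MonoidHom.mk' (fun y => ⟨-c y, p y⟩) fun y z => CocycleExt.ext (by
    have h := hc y z
    simp only [Cocycles.val_pull] at h
    simp only [fst_mul, h]
    abel) (map_mul p y z)

end CocycleExt

/-- A symmetric 2-cocycle of an abelian group with values in a divisible group is a coboundary. -/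
theorem exists_splits_of_symm [DivisibleBy D ℤ] (hX : ∀ x y : X, x * y = y * x)
    (f : Cocycles X D) (hf : ∀ x y, f.val x y = f.val y x) : ∃ b, Splits f b := by
  have hE : commutator (CocycleExt f) = ⊥ := commutator_eq_bot_of_comm fun a b =>
    CocycleExt.ext (by
      simp only [CocycleExt.fst_mul]
      rw [hf, add_comm a.fst]) (hX _ _)
  -- Symmetry makes the extension abelian, so the identity of `D` extends to a retraction `χ` onto
  -- the kernel.
  obtain ⟨χ, hχ⟩ := exists_hom_extension (CocycleExt.ofKer f)
    (AddEquiv.additiveMultiplicative D).toAddMonoidHom fun d hd => by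
      rw [hE, Subgroup.mem_bot] at hd
      have h := congrArg CocycleExt.fst hd
      exact add_eq_left.mp h
  refine ⟨fun x => χ (Additive.ofMul ⟨0, x⟩), fun x y => ?_⟩
  have h : (⟨0, x⟩ * ⟨0, y⟩ : CocycleExt f) =
      CocycleExt.ofKer f (Multiplicative.ofAdd (f.val x y)) * ⟨0, x * y⟩ :=
    CocycleExt.ext (by simp [CocycleExt.ofKer, f.val_one_left]) (by simp [CocycleExt.ofKer])
  rw [← map_add, ← ofMul_mul, h, ofMul_mul, map_add, hχ, add_sub_cancel_right]
  rfl

/-- A 2-cocycle of `X` that is symmetric on `X × N`, for `N` central in `X`, is cohomologous to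
the inflation of a 2-cocycle of `X/N`. -/
theorem exists_splits_sub_inflation [DivisibleBy D ℤ] {N : Subgroup X} [N.Normal]
    (hN : N ≤ Subgroup.center X) (F : Cocycles X D) (hF : ∀ n ∈ N, ∀ x, F.val n x = F.val x n) :
    ∃ (f : Cocycles (X ⧸ N) D) (c : X → D),
      Splits (F - Cocycles.pull (QuotientGroup.mk' N) f) c := by
  have hc : ∀ (n : N) (g : X), (n : X) * g = g * n := fun n g =>
    ((Subgroup.mem_center_iff.mp (hN n.2)) g).symm
  obtain ⟨b, hb⟩ := exists_splits_of_symm (fun x y : N => Subtype.ext (hc x y))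
    (Cocycles.pull N.subtype F) fun x y => hF x x.2 y
  let σ : N →* CocycleExt F := CocycleExt.lift N.subtype b hb
  have hσ : ∀ n a, σ n * a = a * σ n := fun n a => CocycleExt.ext (by
    simp only [CocycleExt.fst_mul]
    rw [show F.val (σ n).snd a.snd = F.val a.snd (σ n).snd from hF n n.2 _, add_comm a.fst])
    (hc n a.snd)
  let r : X ⧸ N → CocycleExt F := fun x => ⟨0, x.out⟩
  let φ : X ⧸ N → X ⧸ N → D := fun x y =>
    (r x * r y).fst - (σ (factorSet N x y) * r (x * y)).fst
  have hr : ∀ x y, r x * r y = CocycleExt.shift (φ x y) (σ (factorSet N x y) * r (x * y)) :=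
    fun x y => CocycleExt.ext (by simp [φ]) (factorSet_mul_out x y).symm
  -- Since `σ` is a homomorphism with central image, the factor set of the section `s` depends only
  -- on cosets of `N`.
  let s : X → CocycleExt F := fun x => σ (normalPart N x) * r x
  have hs_snd : ∀ x, (s x).snd = x := normalPart_mul_out
  have hs : ∀ x y : X, s x * s y = CocycleExt.shift (φ x y) (s (x * y)) := fun x y => by
    simp only [s]
    rw [normalPart_mul hN, map_mul, map_mul, mul_assoc, ← mul_assoc (r x), ← hσ _ (r x),
      mul_assoc, hr, CocycleExt.mul_shift, CocycleExt.mul_shift, mul_assoc, mul_assoc,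
      QuotientGroup.mk_mul]
  have key : ∀ x y : X, F.val x y - φ x y = -(s x).fst + -(s y).fst - -(s (x * y)).fst :=
    fun x y => by
      have h := congrArg CocycleExt.fst (hs x y)
      rw [CocycleExt.fst_mul, hs_snd, hs_snd, CocycleExt.fst_shift] at h
      rw [← sub_eq_zero] at h ⊢
      rw [← h]
      abel
  -- Lifted to `X`, `φ` differs from `F` by a coboundary; every coset has a representative.
  have hφ : IsCocycle φ := fun x y z => by
    induction x using QuotientGroup.induction_on with | _ x
    induction y using QuotientGroup.induction_on with | _ y
    induction z using QuotientGroup.induction_on with | _ z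
    have h := F.isCocycle x y z
    have e : ∀ x y : X, φ x y = F.val x y - (-(s x).fst + -(s y).fst - -(s (x * y)).fst) :=
      fun x y => by rw [← key, sub_sub_cancel]
    rw [← QuotientGroup.mk_mul, ← QuotientGroup.mk_mul, e, e, e, e, mul_assoc]
    rw [← sub_eq_zero] at h ⊢
    rw [← h]
    abel
  exact ⟨Cocycles.mk φ hφ, _, key⟩

end Extension

/-! ### The commutator pairing of a cocycle. -/

section Pairing

variable {X D : Type u} [Group X] [AddCommGroup D] (f : Cocycles X D)

/-- The commutator pairing `f(x, y) - f(y, x)` of a 2-cocycle is additive on centralizers. -/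
theorem pairing_mul_right {x y z : X} (hy : x * y = y * x) (hz : x * z = z * x) :
    f.val x (y * z) - f.val (y * z) x =
      (f.val x y - f.val y x) + (f.val x z - f.val z x) := by
  have h1 := f.isCocycle x y z
  have h2 := f.isCocycle y z x
  have h3 := f.isCocycle y x z
  rw [← hy, hz] at h3
  linear_combination (norm := module) h3 - h1 - h2

theorem pairing_mul_left {x y z : X} (hx : x * z = z * x) (hy : y * z = z * y) :
    f.val (x * y) z - f.val z (x * y) =
      (f.val x z - f.val z x) + (f.val y z - f.val z y) := by
  rw [← neg_sub, pairing_mul_right f hx.symm hy.symm]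
  abel

/-- The pairing with `x` is a homomorphism from `K` to an abelian group, so it kills `K'`. -/
theorem val_symm_of_mem_commutator {K : Subgroup X} {x z : X} (hx : ∀ k ∈ K, x * k = k * x)
    (hz : z ∈ ⁅K, K⁆) : f.val x z = f.val z x := by
  let p : Additive K →+ D := AddMonoidHom.mk'
    (fun k => f.val x (k.toMul : K) - f.val (k.toMul : K) x)
    fun k l => pairing_mul_right f (hx _ k.toMul.2) (hx _ l.toMul.2)
  have hzK : z ∈ K := Subgroup.commutator_le_self K hz
  exact sub_eq_zero.mp
    (hom_eq_zero_of_mem_commutator p ((mem_commutator_iff ⟨z, hzK⟩).mpr hz))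

end Pairing

/-! ### Gluing homomorphisms and splittings over A. -/

section Gluing

variable {G : Type u} [Group G] {H K : Subgroup G}

/-- Homomorphisms on the factors of a central product glue if their images commute and they agree
on the amalgamated subgroup. -/
theorem exists_hom_mul {E : Type*} [Group E] (h : IsCentralProduct H K) (a : H →* E) (b : K →* E)
    (hab : ∀ x y, a x * b y = b y * a x)
    (hA : ∀ n (hH : n ∈ H) (hK : n ∈ K), a ⟨n, hH⟩ = b ⟨n, hK⟩) :
    ∃ s : G →* E, ∀ (x : H) (y : K), s (x * y) = a x * b y := by
  have hex : ∀ g : G, ∃ p : H × K, (p.1 * p.2 : G) = g := fun g => by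
    obtain ⟨x, hx, y, hy, e⟩ := h.exists_mul_eq g
    exact ⟨(⟨x, hx⟩, ⟨y, hy⟩), e⟩
  choose σ hσ using hex
  have key : ∀ (x x' : H) (y y' : K), (x * y : G) = x' * y' → a x * b y = a x' * b y' := by
    intro x x' y y' e
    -- Two factorizations of an element differ by an element of H ∩ K, where `a` and `b` agree.
    have e1 : ((x' : G)⁻¹ * x : G) = y' * (y : G)⁻¹ := by
      rw [inv_mul_eq_iff_eq_mul, ← mul_assoc, eq_mul_inv_iff_mul_eq]
      exact e
    have e2 := hA ((x' : G)⁻¹ * x) (x'⁻¹ * x).2 (e1 ▸ (y' * y⁻¹).2)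
    have e3 : b ⟨(x' : G)⁻¹ * x, e1 ▸ (y' * y⁻¹).2⟩ = b (y' * y⁻¹) := congrArg b (Subtype.ext e1)
    rw [e3] at e2
    have e4 : a (x'⁻¹ * x) = b (y' * y⁻¹) := e2
    rw [map_mul, map_mul, map_inv, map_inv, inv_mul_eq_iff_eq_mul, ← mul_assoc,
      eq_mul_inv_iff_mul_eq] at e4
    exact e4
  refine ⟨MonoidHom.mk' (fun g => a (σ g).1 * b (σ g).2) fun g g' => ?_,
    fun x y => key _ _ _ _ (hσ _)⟩
  have e : a (σ g).1 * b (σ g).2 * (a (σ g').1 * b (σ g').2) =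
      a ((σ g).1 * (σ g').1) * b ((σ g).2 * (σ g').2) := by
    rw [map_mul, map_mul, mul_assoc, ← mul_assoc (b _), ← hab]
    simp only [mul_assoc]
  rw [e]
  refine key _ _ _ _ ?_
  rw [hσ, Subgroup.coe_mul, Subgroup.coe_mul, mul_assoc, ← mul_assoc ((σ g').1 : G),
    commute_of_mem h (σ g').1.2 (σ g).2.2, mul_assoc, hσ, ← mul_assoc, hσ]

/-- A 2-cocycle of a central product is a coboundary if it is so on the factors, by cochains that
agree on the amalgamated subgroup, and its commutator pairing between the factors is zero. -/
theorem exists_splits_of_factors {D : Type u} [AddCommGroup D] (h : IsCentralProduct H K)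
    (F : Cocycles G D) (cH : H → D) (cK : K → D) (hH : Splits (Cocycles.pull H.subtype F) cH)
    (hK : Splits (Cocycles.pull K.subtype F) cK)
    (hA : ∀ n (hH : n ∈ H) (hK : n ∈ K), cH ⟨n, hH⟩ = cK ⟨n, hK⟩)
    (hF : ∀ (x : H) (y : K), F.val x y = F.val y x) : ∃ c, Splits F c := by
  obtain ⟨s, hs⟩ := exists_hom_mul h (CocycleExt.lift H.subtype cH hH)
    (CocycleExt.lift K.subtype cK hK)
    (fun x y => CocycleExt.ext (by
      simp only [CocycleExt.fst_mul]
      rw [add_comm (CocycleExt.fst _)]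
      exact congrArg _ (hF x y)) (commute_of_mem h x.2 y.2))
    (fun n h1 h2 => CocycleExt.ext (congrArg Neg.neg (hA n h1 h2)) rfl)
  -- The glued homomorphism is a section of the extension by `F`, which therefore splits.
  have hs_snd : ∀ g, (s g).snd = g := fun g => by
    obtain ⟨x, hx, y, hy, rfl⟩ := h.exists_mul_eq g
    exact congrArg CocycleExt.snd (hs ⟨x, hx⟩ ⟨y, hy⟩)
  refine ⟨fun g => -(s g).fst, fun x y => ?_⟩
  simp only [map_mul, CocycleExt.fst_mul, hs_snd]
  abel

end Gluing

/-! ### The kernel of the transgression. -/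

section Tra

variable {G D : Type u} [Group G] [AddCommGroup D]

theorem classOf_eq_tra_iff (H B : Subgroup G) [B.Normal] (hBH : B ≤ H)
    (hc : B.subgroupOf H ≤ Subgroup.center H) (f : Cocycles (H ⧸ B.subgroupOf H) D)
    (β : HomTo B D) :
    classOf _ D f = tra D H B hBH hc β ↔
      ∃ c, Splits (Cocycles.pull (QuotientGroup.mk' (B.subgroupOf H)) f) c ∧
        ∀ n (hn : n ∈ B), β (Additive.ofMul ⟨n, hn⟩) = f.val 1 1 - c ⟨n, hBH hn⟩ := by
  refine (classOf_eq_transgression_iff hc f _).trans (exists_congr fun c => and_congr_right ?_)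
  refine fun _ => ⟨fun h n hn => h ⟨⟨n, hBH hn⟩, hn⟩, fun h n => h n.1 n.2⟩

/-- A cochain splitting the zero cocycle is a homomorphism on `H`. Hence the transgression vanishes
exactly when `β` extends to `H`, and the only obstruction to extending is `B ∩ H'`. -/
theorem tra_eq_zero_iff [DivisibleBy D ℤ] (H B : Subgroup G) [B.Normal] (hBH : B ≤ H)
    (hc : B.subgroupOf H ≤ Subgroup.center H) (β : HomTo B D) :
    tra D H B hBH hc β = 0 ↔ ∀ n (hn : n ∈ B), n ∈ ⁅H, H⁆ → β (Additive.ofMul ⟨n, hn⟩) = 0 := by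
  rw [eq_comm, ← map_zero (classOf _ D), classOf_eq_tra_iff]
  constructor
  · rintro ⟨c, h, hβ⟩ n hn hn'
    let χ : Additive H →+ D := AddMonoidHom.mk' (fun x => c x.toMul) fun x y =>
      (sub_eq_zero.mp (h x.toMul y.toMul).symm).symm
    have e : χ (Additive.ofMul ⟨n, hBH hn⟩) = 0 :=
      hom_eq_zero_of_mem_commutator χ ((mem_commutator_iff ⟨n, hBH hn⟩).mpr hn')
    rw [hβ, show c ⟨n, hBH hn⟩ = 0 from e, sub_zero]
    rfl
  · intro hβ
    obtain ⟨χ, hχ⟩ := exists_hom_extension (Subgroup.inclusion hBH) β fun x hx =>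
      hβ x x.2 ((mem_commutator_iff _).mp hx)
    refine ⟨fun x => -χ (Additive.ofMul x), fun x y => ?_, fun n hn => ?_⟩
    · simp only [ofMul_mul, map_add]
      refine Eq.trans (b := 0) rfl ?_
      abel
    · rw [← hχ, sub_neg_eq_add]
      exact (zero_add _).symm

end Tra

end CentralProduct

namespace CentralProduct

/-! ### The groups L and M. -/

section Quotient

variable {G D : Type u} [Group G] [AddCommGroup D]

/-- The homomorphism `P/N → D` induced by a homomorphism `P → D` that vanishes on `N`. -/
def homLift {P : Type u} [Group P] (N : Subgroup P) [N.Normal] (β : HomTo P D)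
    (hβ : ∀ x ∈ N, β (Additive.ofMul x) = 0) : HomTo (P ⧸ N) D :=
  MonoidHom.toAdditiveLeft (QuotientGroup.lift N (AddMonoidHom.toMultiplicativeRight β) hβ)

theorem homTo_ext {P : Type u} [Group P] {β γ : HomTo P D}
    (h : ∀ x, β (Additive.ofMul x) = γ (Additive.ofMul x)) : β = γ :=
  DFunLike.ext _ _ h

/-- The image under the transgression of the homomorphisms vanishing on `Z`. -/
theorem nonempty_map_tra_equiv [DivisibleBy D ℤ] (X A Z : Subgroup G) [A.Normal] [Z.Normal]
    (hAX : A ≤ X) (hc : A.subgroupOf X ≤ Subgroup.center X)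
    (hZ : Z ≤ ⁅X, X⁆) :
    Nonempty ((vanishingOn D A Z).map (tra D X A hAX hc) ≃+
      HomTo (↥(A ⊓ ⁅X, X⁆) ⧸ Z.subgroupOf (A ⊓ ⁅X, X⁆)) D) := by
  have hA : commutator A = ⊥ := commutator_eq_bot_of_comm fun x y => Subtype.ext
    (congrArg (fun z : X => (z : G)) (Subgroup.mem_center_iff.mp
      (hc (show (⟨y, hAX y.2⟩ : X) ∈ A.subgroupOf X from y.2)) ⟨x, hAX x.2⟩))
  let i : ↥(A ⊓ ⁅X, X⁆) →* A := Subgroup.inclusion inf_le_left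
  let ψ : vanishingOn D A Z →+ HomTo (↥(A ⊓ ⁅X, X⁆) ⧸ Z.subgroupOf (A ⊓ ⁅X, X⁆)) D :=
    AddMonoidHom.mk' (fun β => homLift _ (β.1.comp (MonoidHom.toAdditive i))
      fun x hx => β.2 (i x) hx) fun β γ => homTo_ext fun x => by
        induction x using QuotientGroup.induction_on
        rfl
  -- Transgression and restriction to `A ∩ X'` have the same kernel; restriction is onto because `A`
  -- is abelian and `D` divisible.
  refine nonempty_addEquiv_of_ker_eq ((tra D X A hAX hc).addSubgroupMap _) ψ
    (AddMonoidHom.addSubgroupMap_surjective _ _) (fun χ => ?_) fun β => ?_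
  · obtain ⟨β, hβ⟩ := exists_hom_extension i
      (χ.comp (MonoidHom.toAdditive (QuotientGroup.mk' (Z.subgroupOf (A ⊓ ⁅X, X⁆)))))
      fun x hx => by
        rw [hA, Subgroup.mem_bot] at hx
        rw [show x = 1 from Subtype.ext (congrArg (fun a : A => (a : G)) hx)]
        exact map_zero _
    have hβZ : β ∈ vanishingOn D A Z := fun a ha => by
      refine (hβ ⟨a, a.2, hZ ha⟩).trans ?_
      have e : QuotientGroup.mk' (Z.subgroupOf (A ⊓ ⁅X, X⁆)) ⟨a, a.2, hZ ha⟩ = 1 :=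
        (QuotientGroup.eq_one_iff _).mpr ha
      exact (congrArg (fun x => χ (Additive.ofMul x)) e).trans (map_zero χ)
    refine ⟨⟨β, hβZ⟩, homTo_ext fun x => ?_⟩
    induction x using QuotientGroup.induction_on with | _ x
    exact hβ x
  · rw [← ZeroMemClass.coe_eq_zero]
    refine (tra_eq_zero_iff X A hAX hc β.1).trans ⟨fun h => homTo_ext fun x => ?_,
      fun h n hn hn' => ?_⟩
    · induction x using QuotientGroup.induction_on with | _ x
      exact h x x.2.1 x.2.2
    · exact DFunLike.congr_fun h (Additive.ofMul
        (QuotientGroup.mk' (Z.subgroupOf (A ⊓ ⁅X, X⁆)) ⟨n, hn, hn'⟩))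

end Quotient

/-! ### The abelian tensor product and cup product cocycles. -/

section Tensor

variable {X Y D : Type u} [Group X] [Group Y] [AddCommGroup D]

/-- The homomorphism on the abelianization induced by a homomorphism to an abelian group. -/
def abLift {Y D : Type*} [Group Y] [AddCommGroup D] (β : Additive Y →+ D) :
    Additive (Abelianization Y) →+ D :=
  MonoidHom.toAdditiveLeft (Abelianization.lift (AddMonoidHom.toMultiplicativeRight β))

/-- The elementary tensor `x ⊗ y`. -/
def abTmul (x : X) (y : Y) : AbTensor X Y :=
  Additive.ofMul (Abelianization.of x) ⊗ₜ[ℤ] Additive.ofMul (Abelianization.of y)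

theorem abTmul_mul_left (x x' : X) (y : Y) :
    abTmul (x * x') y = abTmul x y + abTmul x' y := by
  simp [abTmul, TensorProduct.add_tmul]

theorem abTmul_mul_right (x : X) (y y' : Y) :
    abTmul x (y * y') = abTmul x y + abTmul x y' := by
  simp [abTmul, TensorProduct.tmul_add]

@[simp]
theorem abTmul_one_left (y : Y) : abTmul (1 : X) y = 0 := by simp [abTmul]

@[simp]
theorem abTmul_one_right (x : X) : abTmul x (1 : Y) = 0 := by simp [abTmul]

theorem abTensor_hom_ext {s t : AbTensor X Y →+ D}
    (h : ∀ x y, s (abTmul x y) = t (abTmul x y)) : s = t := by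
  ext z
  induction z using TensorProduct.induction_on with
  | zero => simp
  | add a b ha hb => rw [map_add, map_add, ha, hb]
  | tmul a b =>
    obtain ⟨x, hx⟩ := QuotientGroup.mk_surjective a.toMul
    obtain ⟨y, hy⟩ := QuotientGroup.mk_surjective b.toMul
    have e : a ⊗ₜ[ℤ] b = abTmul x y := by
      rw [← ofMul_toMul a, ← ofMul_toMul b, ← hx, ← hy]
      rfl
    rw [e, h]

/-- The homomorphism on the abelian tensor product induced by a bimultiplicative map. -/
def abTensorLift (p : X → Y → D) (hl : ∀ x x' y, p (x * x') y = p x y + p x' y)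
    (hr : ∀ x y y', p x (y * y') = p x y + p x y') : AbTensor X Y →+ D :=
  TensorProduct.liftAddHom
    (abLift (AddMonoidHom.mk'
      (fun x : Additive X => abLift (AddMonoidHom.mk' (fun y : Additive Y => p x.toMul y.toMul)
        fun y y' => hr _ _ _))
      fun x x' => by
        ext y
        exact hl _ _ _))
    fun r a b => by rw [map_zsmul, map_zsmul]; rfl

/-- The 2-cocycle `(g, g') ↦ t(p(g) ⊗ q(g'))`. -/
def cupCocycle {G : Type u} [Group G] (p : G →* X) (q : G →* Y) :
    (AbTensor X Y →+ D) →+ Cocycles G D where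
  toFun t := Cocycles.mk (fun g g' => t (abTmul (p g) (q g'))) fun x y z => by
    simp only [map_mul, abTmul_mul_left, abTmul_mul_right, map_add]
    abel
  map_zero' := rfl
  map_add' _ _ := rfl

end Tensor

/-! ### Splitting homomorphisms on A. -/

section Decomposition

variable {G D : Type u} [Group G] [AddCommGroup D] [DivisibleBy D ℤ]

/-- A homomorphism on an abelian group that vanishes on `P ∩ Q` can be changed to vanish on `Q`
while keeping its values on `P`. -/
theorem exists_hom_eq_of_vanishingOn (A P Q : Subgroup G) [Q.Normal]
    (hA : ∀ x y : A, x * y = y * x) {β : HomTo A D} (hβ : β ∈ vanishingOn D A (P ⊓ Q)) :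
    ∃ γ : HomTo A D, (∀ a : A, (a : G) ∈ P → γ (Additive.ofMul a) = β (Additive.ofMul a)) ∧
      γ ∈ vanishingOn D A Q := by
  have hY : commutator (A ⧸ Q.subgroupOf A) = ⊥ := commutator_eq_bot_of_comm fun x y => by
    induction x using QuotientGroup.induction_on with | _ x
    induction y using QuotientGroup.induction_on with | _ y
    exact congrArg _ (hA x y)
  obtain ⟨χ, hχ⟩ := exists_hom_extension
    ((QuotientGroup.mk' (Q.subgroupOf A)).comp (P.subgroupOf A).subtype)
    (β.comp (MonoidHom.toAdditive (P.subgroupOf A).subtype)) fun x hx => by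
      rw [hY, Subgroup.mem_bot] at hx
      exact hβ x ⟨x.2, (QuotientGroup.eq_one_iff (N := Q.subgroupOf A) (x : A)).mp hx⟩
  refine ⟨χ.comp (MonoidHom.toAdditive (QuotientGroup.mk' (Q.subgroupOf A))),
    fun a ha => hχ ⟨a, ha⟩, fun a ha => ?_⟩
  have e : QuotientGroup.mk' (Q.subgroupOf A) a = 1 := (QuotientGroup.eq_one_iff _).mpr ha
  exact (congrArg (fun x => χ (Additive.ofMul x)) e).trans (map_zero χ)

end Decomposition

end CentralProduct

namespace CentralProduct

/-! ### The role of Z, and the groups N₁ and N₂. -/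

section Amalgam

variable {G D : Type u} [Group G] [AddCommGroup D] {H K : Subgroup G}

theorem inf_comm_of_isCentralProduct (h : IsCentralProduct H K) (x y : ↥(H ⊓ K)) :
    x * y = y * x :=
  Subtype.ext (commute_of_mem h x.2.1 y.2.2)

theorem Z_le_inf : Z H K ≤ H ⊓ K := le_inf Z_le_left Z_le_right

theorem Z_le_center (h : IsCentralProduct H K) : Z H K ≤ Subgroup.center G := fun z hz => by
  refine Subgroup.mem_center_iff.mpr fun g => ?_
  obtain ⟨x, hx, y, hy, rfl⟩ := h.exists_mul_eq g
  rw [mul_assoc, ← commute_of_mem h (Z_le_left hz) hy, ← mul_assoc,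
    commute_of_mem h hx (Z_le_right hz), mul_assoc]

/-- 2-cocycles of a central product are symmetric on `Z × G`. -/
theorem val_symm_of_mem_Z (h : IsCentralProduct H K) (F : Cocycles G D) {z : G} (hz : z ∈ Z H K)
    (g : G) : F.val z g = F.val g z := by
  obtain ⟨x, hx, y, hy, rfl⟩ := h.exists_mul_eq g
  have h1 := val_symm_of_mem_commutator F (fun k hk => commute_of_mem h hx hk) hz.2
  have h2 := val_symm_of_mem_commutator F (fun k hk => (commute_of_mem h hk hy).symm) hz.1
  have e := pairing_mul_left F (commute_of_mem h hx (Z_le_right hz))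
    (commute_of_mem h (Z_le_left hz) hy).symm
  rw [h1, h2, sub_self, sub_self, add_zero] at e
  exact (sub_eq_zero.mp e).symm

variable [H.Normal] [K.Normal] [DivisibleBy D ℤ] (h : IsCentralProduct H K)

/-- Changing `β` by the kernel of the transgression does not affect its values on Z, since Z ≤ A ∩
H'. -/
theorem traHA_mem_L_iff (β : HomTo ↥(H ⊓ K) D) :
    traHA D h β ∈ L D h ↔ β ∈ vanishingOn D (H ⊓ K) (Z H K) := by
  refine ⟨?_, fun hβ => AddSubgroup.mem_map_of_mem _ hβ⟩
  rintro ⟨γ, hγ, e⟩ a ha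
  rw [← sub_eq_zero, ← map_sub] at e
  have h1 := (tra_eq_zero_iff _ _ _ _ _).mp e a a.2 ha.1
  rw [AddMonoidHom.sub_apply, sub_eq_zero] at h1
  exact h1.symm.trans (hγ a ha)

theorem traKA_mem_M_iff (β : HomTo ↥(H ⊓ K) D) :
    traKA D h β ∈ M D h ↔ β ∈ vanishingOn D (H ⊓ K) (Z H K) := by
  refine ⟨?_, fun hβ => AddSubgroup.mem_map_of_mem _ hβ⟩
  rintro ⟨γ, hγ, e⟩ a ha
  rw [← sub_eq_zero, ← map_sub] at e
  have h1 := (tra_eq_zero_iff _ _ _ _ _).mp e a a.2 ha.2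
  rw [AddMonoidHom.sub_apply, sub_eq_zero] at h1
  exact h1.symm.trans (hγ a ha)

theorem nonempty_N₁_equiv : Nonempty (N₁ D h ≃+ HomTo ↥(Z H K) D) := by
  let i : ↥(Z H K) →* ↥(H ⊓ K) := Subgroup.inclusion Z_le_inf
  refine nonempty_addEquiv_of_ker_eq (AddMonoidHom.rangeRestrict _)
    (AddMonoidHom.compHom' (MonoidHom.toAdditive i)) (AddMonoidHom.rangeRestrict_surjective _)
    (fun χ => ?_) fun β => ?_
  · obtain ⟨β, hβ⟩ := exists_hom_extension i χ fun x hx => by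
      rw [commutator_eq_bot_of_comm (inf_comm_of_isCentralProduct h), Subgroup.mem_bot] at hx
      rw [show x = 1 from Subtype.ext (congrArg (fun a : ↥(H ⊓ K) => (a : G)) hx)]
      exact map_zero _
    exact ⟨β, homTo_ext hβ⟩
  · rw [← ZeroMemClass.coe_eq_zero]
    refine Prod.ext_iff.trans (((and_congr
      ((QuotientAddGroup.eq_zero_iff _).trans (traHA_mem_L_iff h β))
      ((QuotientAddGroup.eq_zero_iff _).trans (traKA_mem_M_iff h β))).trans (and_self_iff)).trans
      ⟨fun hβ => homTo_ext fun x => hβ (i x) x.2, fun e a ha => ?_⟩)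
    exact DFunLike.congr_fun e (Additive.ofMul ⟨a, ha⟩)

/-- As Z ≤ H', the transgression to H/Z is already injective. -/
theorem nonempty_N₂_equiv : Nonempty (N₂ D h ≃+ HomTo ↥(Z H K) D) := by
  refine nonempty_addEquiv_of_ker_eq (AddMonoidHom.rangeRestrict _)
    (AddMonoidHom.id _) (AddMonoidHom.rangeRestrict_surjective _) Function.surjective_id
    fun β => ?_
  rw [← ZeroMemClass.coe_eq_zero]
  refine ⟨fun e => homTo_ext fun x => ?_, fun e => ?_⟩
  · exact (tra_eq_zero_iff _ _ _ _ _).mp (congrArg Prod.fst e) x x.2 x.2.1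
  · rw [show β = 0 from e]
    exact map_zero ((traHZ D h).prod (traKZ D h))

/-- Modulo `L` and `M`, the pairs of transgressions of `Hom(A, D)` do not grow. -/
theorem mk_mem_N₁_iff (x : H2 (H ⧸ (H ⊓ K).subgroupOf H) D)
    (y : H2 (K ⧸ (H ⊓ K).subgroupOf K) D) :
    (QuotientAddGroup.mk' (L D h) x, QuotientAddGroup.mk' (M D h) y) ∈ N₁ D h ↔
      ∃ β, x = traHA D h β ∧ y = traKA D h β := by
  constructor
  · rintro ⟨β, e⟩
    obtain ⟨⟨β₁, h1, e1⟩, ⟨β₂, h2, e2⟩⟩ :=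
      And.intro (QuotientAddGroup.eq.mp (congrArg Prod.fst e))
        (QuotientAddGroup.eq.mp (congrArg Prod.snd e))
    have hA := inf_comm_of_isCentralProduct h
    -- `γ₁` has the transgression of `β₁` to H/A and zero transgression to K/A; `γ₂` plays the
    -- mirror role. Adding both to `β` corrects each coordinate independently.
    obtain ⟨γ₁, hγ₁, hγ₁'⟩ := exists_hom_eq_of_vanishingOn (H ⊓ K) ⁅H, H⁆ ⁅K, K⁆ hA h1
    obtain ⟨γ₂, hγ₂, hγ₂'⟩ := exists_hom_eq_of_vanishingOn (H ⊓ K) ⁅K, K⁆ ⁅H, H⁆ hA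
      (show β₂ ∈ vanishingOn D (H ⊓ K) (⁅K, K⁆ ⊓ ⁅H, H⁆) from fun a ha => h2 a ⟨ha.2, ha.1⟩)
    have t1 : traHA D h (γ₁ - β₁) = 0 := (tra_eq_zero_iff _ _ _ _ _).mpr fun n hn hn' => by
      rw [AddMonoidHom.sub_apply, hγ₁ ⟨n, hn⟩ hn', sub_self]
    have t2 : traHA D h γ₂ = 0 := (tra_eq_zero_iff _ _ _ _ _).mpr fun n hn hn' =>
      hγ₂' ⟨n, hn⟩ hn'
    have t3 : traKA D h (γ₂ - β₂) = 0 := (tra_eq_zero_iff _ _ _ _ _).mpr fun n hn hn' => by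
      rw [AddMonoidHom.sub_apply, hγ₂ ⟨n, hn⟩ hn', sub_self]
    have t4 : traKA D h γ₁ = 0 := (tra_eq_zero_iff _ _ _ _ _).mpr fun n hn hn' =>
      hγ₁' ⟨n, hn⟩ hn'
    rw [map_sub, sub_eq_zero] at t1 t3
    refine ⟨β + γ₁ + γ₂, ?_, ?_⟩
    · rw [map_add, map_add, t1, t2, add_zero]
      exact (neg_add_eq_iff_eq_add.mp e1.symm)
    · rw [map_add, map_add, t3, t4, add_zero]
      exact (neg_add_eq_iff_eq_add.mp e2.symm)
  · rintro ⟨β, rfl, rfl⟩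
    exact ⟨β, rfl⟩

end Amalgam

end CentralProduct

namespace CentralProduct

/-! ### Part (i): inflation from H/A and K/A. -/

section InflationFromFactors

variable {G D : Type u} [Group G] [AddCommGroup D] {H K : Subgroup G}

/-- These are the projections G → G/K ≅ H/A and G → G/H ≅ K/A, glued from a quotient map and a
trivial map. -/
theorem exists_projections [H.Normal] [K.Normal] (h : IsCentralProduct H K) :
    ∃ (p : G →* H ⧸ (H ⊓ K).subgroupOf H) (q : G →* K ⧸ (H ⊓ K).subgroupOf K),
      (∀ x : H, p x = x) ∧ (∀ y : K, p y = 1) ∧ (∀ x : H, q x = 1) ∧ ∀ y : K, q y = y := by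
  obtain ⟨p, hp⟩ := exists_hom_mul h (QuotientGroup.mk' ((H ⊓ K).subgroupOf H)) 1
    (fun x y => by simp) (fun n hH hK => (QuotientGroup.eq_one_iff _).mpr ⟨hH, hK⟩)
  obtain ⟨q, hq⟩ := exists_hom_mul h 1 (QuotientGroup.mk' ((H ⊓ K).subgroupOf K))
    (fun x y => by simp) (fun n hH hK => Eq.symm
      ((QuotientGroup.eq_one_iff (N := (H ⊓ K).subgroupOf K) ⟨n, hK⟩).mpr ⟨hH, hK⟩))
  refine ⟨p, q, fun x => ?_, fun y => ?_, fun x => ?_, fun y => ?_⟩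
  · simpa using hp x 1
  · simpa using hp 1 y
  · simpa using hq x 1
  · simpa using hq 1 y

/-- The sum of the inflations of 2-cocycles of the factors and of the cup product cocycle of a
bilinear map is a coboundary on the central product exactly when the bilinear map is zero and the
2-cocycles represent the transgressions of one homomorphism. -/
theorem classOf_inflation_eq_zero_iff [H.Normal] [K.Normal] (h : IsCentralProduct H K)
    {p : G →* H ⧸ (H ⊓ K).subgroupOf H} {q : G →* K ⧸ (H ⊓ K).subgroupOf K}
    (pH : ∀ x : H, p x = x) (pK : ∀ y : K, p y = 1) (qH : ∀ x : H, q x = 1)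
    (qK : ∀ y : K, q y = y)
    (f₁ : Cocycles (H ⧸ (H ⊓ K).subgroupOf H) D) (f₂ : Cocycles (K ⧸ (H ⊓ K).subgroupOf K) D)
    (t : AbTensor (H ⧸ (H ⊓ K).subgroupOf H) (K ⧸ (H ⊓ K).subgroupOf K) →+ D) :
    classOf G D (Cocycles.pull p f₁ + Cocycles.pull q f₂ + cupCocycle p q t) = 0 ↔
      (∃ β, classOf _ D f₁ = traHA D h β ∧ classOf _ D f₂ = traKA D h β) ∧ t = 0 := by
  rw [classOf_eq_zero_iff]
  have hval : ∀ g g', (Cocycles.pull p f₁ + Cocycles.pull q f₂ + cupCocycle p q t).val g g' =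
      f₁.val (p g) (p g') + f₂.val (q g) (q g') + t (abTmul (p g) (q g')) := fun _ _ => rfl
  constructor
  · rintro ⟨c, hc⟩
    have hc' := fun x y => (hval x y).symm.trans (hc x y)
    have pA : ∀ n : ↥(H ⊓ K), p n = 1 := fun n => pK ⟨n, n.2.2⟩
    have qA : ∀ n : ↥(H ⊓ K), q n = 1 := fun n => qH ⟨n, n.2.1⟩
    -- On A the total cocycle is the constant `f₁.val 1 1 + f₂.val 1 1`, so this constant minus `c`
    -- is additive. Below, each factor subtracts the other's constant.
    let β : HomTo ↥(H ⊓ K) D := AddMonoidHom.mk'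
      (fun n => f₁.val 1 1 + f₂.val 1 1 - c (n.toMul : ↥(H ⊓ K))) fun m n => by
        have e := hc' (m.toMul : ↥(H ⊓ K)) (n.toMul : ↥(H ⊓ K))
        rw [pA, pA, qA, qA, abTmul_one_left, map_zero, add_zero] at e
        simp only [toMul_add, Subgroup.coe_mul]
        linear_combination (norm := module) -e
    refine ⟨⟨β, (classOf_eq_tra_iff _ _ _ _ _ _).mpr ⟨fun x => c x - f₂.val 1 1, fun x y => ?_,
      fun n hn => ?_⟩, (classOf_eq_tra_iff _ _ _ _ _ _).mpr ⟨fun x => c x - f₁.val 1 1,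
      fun x y => ?_, fun n hn => ?_⟩⟩, abTensor_hom_ext fun x y => ?_⟩
    · have e := hc' x y
      rw [pH, pH, qH, qH, abTmul_one_right, map_zero, add_zero] at e
      simp only [Cocycles.val_pull, QuotientGroup.mk'_apply, Subgroup.coe_mul]
      linear_combination (norm := module) e
    · change f₁.val 1 1 + f₂.val 1 1 - c n = f₁.val 1 1 - (c n - f₂.val 1 1)
      abel
    · have e := hc' x y
      rw [pK, pK, qK, qK, abTmul_one_left, map_zero, add_zero] at e
      simp only [Cocycles.val_pull, QuotientGroup.mk'_apply, Subgroup.coe_mul]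
      linear_combination (norm := module) e
    · change f₁.val 1 1 + f₂.val 1 1 - c n = f₂.val 1 1 - (c n - f₁.val 1 1)
      abel
    · induction x using QuotientGroup.induction_on with | _ x
      induction y using QuotientGroup.induction_on with | _ y
      -- The cup product contributes at `(x, y)` but not at `(y, x)`, while the inflated terms
      -- agree; the difference isolates `t`.
      have e₁ := hc' x y
      have e₂ := hc' y x
      rw [pH, qK, pK, qH, f₁.val_one_right, f₂.val_one_left] at e₁
      rw [pH, qK, pK, qH, f₁.val_one_left, f₂.val_one_right, abTmul_one_left, map_zero,
        ← commute_of_mem h x.2 y.2] at e₂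
      rw [AddMonoidHom.zero_apply]
      linear_combination (norm := module) e₁ - e₂
  · rintro ⟨⟨β, h₁, h₂⟩, rfl⟩
    obtain ⟨c₁, hc₁, hβ₁⟩ := (classOf_eq_tra_iff _ _ _ _ _ _).mp h₁
    obtain ⟨c₂, hc₂, hβ₂⟩ := (classOf_eq_tra_iff _ _ _ _ _ _).mp h₂
    refine exists_splits_of_factors h _ (fun x => c₁ x + f₂.val 1 1)
      (fun y => c₂ y + f₁.val 1 1) (fun x y => ?_) (fun x y => ?_) (fun n hH hK => ?_)
      fun x y => ?_
    · have e := hc₁ x y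
      simp only [Cocycles.val_pull, QuotientGroup.mk'_apply] at e
      rw [Cocycles.val_pull, Subgroup.coe_subtype, hval, pH, pH, qH, qH, AddMonoidHom.zero_apply]
      linear_combination (norm := module) e
    · have e := hc₂ x y
      simp only [Cocycles.val_pull, QuotientGroup.mk'_apply] at e
      rw [Cocycles.val_pull, Subgroup.coe_subtype, hval, pK, pK, qK, qK, AddMonoidHom.zero_apply]
      linear_combination (norm := module) e
    · have e₁ := hβ₁ n ⟨hH, hK⟩
      have e₂ := hβ₂ n ⟨hH, hK⟩
      linear_combination (norm := module) e₁ - e₂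
    · rw [hval, hval, pH, pK, qH, qK, f₁.val_one_left x, f₁.val_one_right x, f₂.val_one_left y,
        f₂.val_one_right y, AddMonoidHom.zero_apply, AddMonoidHom.zero_apply]

end InflationFromFactors

/-! ### Part (ii): restriction from G/Z to H/Z and K/Z. -/

section RestrictionToFactors

variable {G : Type u} (D : Type u) [Group G] [AddCommGroup D] {H K : Subgroup G}

/-- The homomorphism `X/N → G/N` induced by the inclusion of a subgroup `X`. -/
def quotientInclusion (X N : Subgroup G) [N.Normal] : X ⧸ N.subgroupOf X →* G ⧸ N :=
  QuotientGroup.map _ _ X.subtype le_rfl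

/-- The commutator pairing `H ⊗ K → D` of a 2-cocycle of `G/N`. -/
def pairingHom (h : IsCentralProduct H K) (N : Subgroup G) [N.Normal] :
    Cocycles (G ⧸ N) D →+ (AbTensor H K →+ D) :=
  have comm : ∀ (x : H) (y : K), ((x : G) * (y : G) : G ⧸ N) = (y : G) * (x : G) :=
    fun x y => congrArg _ (commute_of_mem h x.2 y.2)
  AddMonoidHom.mk'
    (fun f => abTensorLift
      (fun x y => f.val (x : G) (y : G) - f.val (y : G) (x : G))
      (fun x x' y => pairing_mul_left f (comm x y) (comm x' y))
      fun x y y' => pairing_mul_right f (comm x y) (comm x y'))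
    fun _ _ => abTensor_hom_ext fun _ _ => add_sub_add_comm _ _ _ _

theorem pairingHom_abTmul (h : IsCentralProduct H K) (N : Subgroup G) [N.Normal]
    (f : Cocycles (G ⧸ N) D) (x : H) (y : K) :
    pairingHom D h N f (abTmul x y) = f.val (x : G) (y : G) - f.val (y : G) (x : G) := rfl

variable {D} [H.Normal] [K.Normal] [DivisibleBy D ℤ]

/-- A 2-cocycle of `G/Z` inflates to a coboundary of `G` exactly when its restrictions to `H/Z` and
`K/Z` represent the transgressions of one homomorphism and its commutator pairing vanishes. -/
theorem classOf_inflation_Z_eq_zero_iff (h : IsCentralProduct H K)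
    (f : Cocycles (G ⧸ Z H K) D) :
    classOf G D (Cocycles.pull (QuotientGroup.mk' (Z H K)) f) = 0 ↔
      (∃ β, traHZ D h β = classOf _ D (Cocycles.pull (quotientInclusion H (Z H K)) f) ∧
        traKZ D h β = classOf _ D (Cocycles.pull (quotientInclusion K (Z H K)) f)) ∧
      pairingHom D h (Z H K) f = 0 := by
  rw [classOf_eq_zero_iff]
  constructor
  · rintro ⟨c, hc⟩
    let β : HomTo ↥(Z H K) D := AddMonoidHom.mk'
      (fun n => f.val 1 1 - c (n.toMul : ↥(Z H K))) fun m n => by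
        have e := hc (m.toMul : ↥(Z H K)) (n.toMul : ↥(Z H K))
        have hm : QuotientGroup.mk' (Z H K) (m.toMul : ↥(Z H K)) = 1 :=
          (QuotientGroup.eq_one_iff _).mpr m.toMul.2
        have hn : QuotientGroup.mk' (Z H K) (n.toMul : ↥(Z H K)) = 1 :=
          (QuotientGroup.eq_one_iff _).mpr n.toMul.2
        rw [Cocycles.val_pull, hm, hn] at e
        simp only [toMul_add, Subgroup.coe_mul]
        linear_combination (norm := module) -e
    refine ⟨⟨β, ((classOf_eq_tra_iff _ _ _ _ _ _).mpr ⟨fun x => c x, fun x y => hc x y,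
      fun n hn => ?_⟩).symm, ((classOf_eq_tra_iff _ _ _ _ _ _).mpr ⟨fun x => c x,
      fun x y => hc x y, fun n hn => ?_⟩).symm⟩, abTensor_hom_ext fun x y => ?_⟩
    · rw [Cocycles.val_pull, map_one]
      rfl
    · rw [Cocycles.val_pull, map_one]
      rfl
    · have e₁ := hc x y
      have e₂ := hc y x
      rw [← commute_of_mem h x.2 y.2] at e₂
      simp only [Cocycles.val_pull, QuotientGroup.mk'_apply] at e₁ e₂
      rw [pairingHom_abTmul, AddMonoidHom.zero_apply]
      linear_combination (norm := module) e₁ - e₂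
  · rintro ⟨⟨β, h₁, h₂⟩, ht⟩
    obtain ⟨c₁, hc₁, hβ₁⟩ := (classOf_eq_tra_iff _ _ _ _ _ _).mp h₁.symm
    obtain ⟨c₂, hc₂, hβ₂⟩ := (classOf_eq_tra_iff _ _ _ _ _ _).mp h₂.symm
    simp only [Cocycles.val_pull, map_one] at hβ₁ hβ₂
    -- `δ` measures the failure of the two splittings to agree on A; the common `β` makes it vanish
    -- on Z. Its summands `δ - γ` and `γ` extend to H and K, and subtracting `χ₁` and adding `χ₂`
    -- makes the splittings agree.
    let δ : HomTo ↥(H ⊓ K) D := AddMonoidHom.mk'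
      (fun n => c₁ ⟨_, n.toMul.2.1⟩ - c₂ ⟨_, n.toMul.2.2⟩) fun m n => by
        have e₁ := hc₁ ⟨_, m.toMul.2.1⟩ ⟨_, n.toMul.2.1⟩
        have e₂ := hc₂ ⟨_, m.toMul.2.2⟩ ⟨_, n.toMul.2.2⟩
        have e := e₁.symm.trans e₂
        simp only [MulMemClass.mk_mul_mk] at e
        simp only [toMul_add, Subgroup.coe_mul]
        linear_combination (norm := module) -e
    have hδ : δ ∈ vanishingOn D (H ⊓ K) (⁅H, H⁆ ⊓ ⁅K, K⁆) := fun a ha => by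
      have e := (hβ₁ a ha).symm.trans (hβ₂ a ha)
      exact sub_eq_zero.mpr (sub_right_injective e)
    obtain ⟨γ, hγ, hγ'⟩ := exists_hom_eq_of_vanishingOn (H ⊓ K) _ _
      (inf_comm_of_isCentralProduct h) hδ
    obtain ⟨χ₁, hχ₁⟩ := exists_hom_extension (Subgroup.inclusion inf_le_left) (δ - γ)
      fun x hx => by
        rw [AddMonoidHom.sub_apply, hγ x ((mem_commutator_iff _).mp hx), sub_self]
    obtain ⟨χ₂, hχ₂⟩ := exists_hom_extension (Subgroup.inclusion inf_le_right) γ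
      fun x hx => hγ' x ((mem_commutator_iff _).mp hx)
    refine exists_splits_of_factors h _ (fun x => c₁ x - χ₁ (Additive.ofMul x))
      (fun y => c₂ y + χ₂ (Additive.ofMul y)) (fun x y => ?_) (fun x y => ?_)
      (fun n hH hK => ?_) fun x y => ?_
    · have e : _ = c₁ x + c₁ y - c₁ (x * y) := hc₁ x y
      refine e.trans ?_
      simp only [ofMul_mul, map_add]
      abel
    · have e : _ = c₂ x + c₂ y - c₂ (x * y) := hc₂ x y
      refine e.trans ?_
      simp only [ofMul_mul, map_add]
      abel
    · have e₁ : χ₁ (Additive.ofMul ⟨n, hH⟩) =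
        c₁ ⟨n, hH⟩ - c₂ ⟨n, hK⟩ - γ (Additive.ofMul ⟨n, hH, hK⟩) := hχ₁ ⟨n, hH, hK⟩
      have e₂ : χ₂ (Additive.ofMul ⟨n, hK⟩) = γ (Additive.ofMul ⟨n, hH, hK⟩) := hχ₂ ⟨n, hH, hK⟩
      rw [e₁, e₂]
      abel
    · have e := DFunLike.congr_fun ht (abTmul x y)
      exact sub_eq_zero.mp e

end RestrictionToFactors

end CentralProduct

/-! ### The theorem, by comparison of kernels. -/

theorem theoremB {G D : Type u} [Group G] [AddCommGroup D] [DivisibleBy D ℤ]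
    (H K : Subgroup G) [H.Normal] [K.Normal] (h : CentralProduct.IsCentralProduct H K) :
    -- `L ≅ Hom((A ∩ H')/Z, D)`, `M ≅ Hom((A ∩ K')/Z, D)`, `N ≅ Hom(Z, D)`
    Nonempty (CentralProduct.L D h ≃+ CentralProduct.HomTo
      (↥((H ⊓ K) ⊓ ⁅H, H⁆) ⧸ (CentralProduct.Z H K).subgroupOf ((H ⊓ K) ⊓ ⁅H, H⁆)) D) ∧
    Nonempty (CentralProduct.M D h ≃+ CentralProduct.HomTo
      (↥((H ⊓ K) ⊓ ⁅K, K⁆) ⧸ (CentralProduct.Z H K).subgroupOf ((H ⊓ K) ⊓ ⁅K, K⁆)) D) ∧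
    Nonempty (CentralProduct.N₁ D h ≃+ CentralProduct.HomTo ↥(CentralProduct.Z H K) D) ∧
    Nonempty (CentralProduct.N₂ D h ≃+ CentralProduct.HomTo ↥(CentralProduct.Z H K) D) ∧
    -- (i)
    (∃ f : (((CentralProduct.H2 (H ⧸ (H ⊓ K).subgroupOf H) D ⧸ CentralProduct.L D h) ×
          (CentralProduct.H2 (K ⧸ (H ⊓ K).subgroupOf K) D ⧸ CentralProduct.M D h)) ⧸
            CentralProduct.N₁ D h) ×
          (CentralProduct.AbTensor (H ⧸ (H ⊓ K).subgroupOf H) (K ⧸ (H ⊓ K).subgroupOf K) →+ D)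
        →+ CentralProduct.H2 G D,
      Function.Injective f) ∧
    -- (ii)
    (∃ f : CentralProduct.H2 G D →+
        ((CentralProduct.H2 (H ⧸ (CentralProduct.Z H K).subgroupOf H) D ×
          CentralProduct.H2 (K ⧸ (CentralProduct.Z H K).subgroupOf K) D) ⧸
            CentralProduct.N₂ D h) ×
          (CentralProduct.AbTensor H K →+ D),
      Function.Injective f) := by
  open CentralProduct in
  refine ⟨nonempty_map_tra_equiv H (H ⊓ K) (Z H K) _ _ inf_le_left,
    nonempty_map_tra_equiv K (H ⊓ K) (Z H K) _ _ inf_le_right,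
    nonempty_N₁_equiv h, nonempty_N₂_equiv h, ?_, ?_⟩
  · obtain ⟨p, q, pH, pK, qH, qK⟩ := exists_projections h
    let φ := ((QuotientAddGroup.mk' (N₁ D h)).comp
      (((QuotientAddGroup.mk' (L D h)).comp (classOf _ D)).prodMap
        ((QuotientAddGroup.mk' (M D h)).comp (classOf _ D)))).prodMap (AddMonoidHom.id
          (AbTensor (H ⧸ (H ⊓ K).subgroupOf H) (K ⧸ (H ⊓ K).subgroupOf K) →+ D))
    let ψ := (classOf G D).comp
      (((Cocycles.pull p).coprod (Cocycles.pull q)).coprod (cupCocycle p q))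
    obtain ⟨f, hf, -⟩ := exists_injective_of_ker_eq φ ψ
      (((QuotientAddGroup.mk'_surjective _).comp
        (((QuotientAddGroup.mk'_surjective _).comp classOf_surjective).prodMap
          ((QuotientAddGroup.mk'_surjective _).comp classOf_surjective))).prodMap
        Function.surjective_id) fun s => by
      refine Iff.trans ?_ (classOf_inflation_eq_zero_iff h pH pK qH qK s.1.1 s.1.2 s.2).symm
      exact Prod.ext_iff.trans (and_congr_left' ((QuotientAddGroup.eq_zero_iff _).trans
        (mk_mem_N₁_iff h _ _)))
    exact ⟨f, hf⟩
  · let φ := (classOf G D).comp (Cocycles.pull (QuotientGroup.mk' (Z H K)))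
    let ψ := ((QuotientAddGroup.mk' (N₂ D h)).comp
      (((classOf _ D).comp (Cocycles.pull (quotientInclusion H (Z H K)))).prod
        ((classOf _ D).comp (Cocycles.pull (quotientInclusion K (Z H K)))))).prod
      (pairingHom D h (Z H K))
    -- The embedding leaves H²(G, D), so inflation must be the surjective map here: each class is
    -- first represented by a cocycle of G/Z.
    obtain ⟨f, hf, -⟩ := exists_injective_of_ker_eq φ ψ (fun x => by
        obtain ⟨F, rfl⟩ := classOf_surjective x
        obtain ⟨f, c, hc⟩ := exists_splits_sub_inflation (Z_le_center h) F
          fun n hn => val_symm_of_mem_Z h F hn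
        exact ⟨f, (sub_eq_zero.mp ((map_sub (classOf G D) F _).symm.trans
          ((classOf_eq_zero_iff _).mpr ⟨c, hc⟩))).symm⟩) fun s => by
      refine (classOf_inflation_Z_eq_zero_iff h s).trans ?_
      refine Iff.trans ?_ (Prod.ext_iff (x := ψ s) (y := 0)).symm
      refine and_congr_left' ?_
      refine Iff.trans ?_ (QuotientAddGroup.eq_zero_iff _).symm
      exact exists_congr fun β => (Prod.ext_iff (x := (traHZ D h β, traKZ D h β))
        (y := (classOf _ D _, classOf _ D _))).symm
    exact ⟨f, hf⟩
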